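/- Let $p\ge 3$ be a prime. For a finite group $G$ let $$\mathscr S(G)=\Big\{\det\big(a_{gh^{-1}}\big)_{g,h\in G} : a_g\in\mathbb Z \text{ for all } g\in G\Big\}$$ be the set of integer group determinants of $G$, and let $\mathscr S_1(G)$ be the set of elements of $\mathscr S(G)$ that are coprime to $p$. Let $$H_p=\left\{\begin{pmatrix}1&a&c\\0&1&b\\0&0&1\end{pmatrix} : a,b,c\in\mathbb Z/p\mathbb Z\right\}$$ be the Heisenberg group of order $p^3$, under matrix multiplication, and let $$\mathscr T_3=\{m\in\mathbb Z : m\equiv a^{p^2} \bmod p^3 \text{ for some integer } a \text{ with } 1\le a<p\}.$$ Then $$\mathscr S_1(H_p)=\mathscr T_3=\{x\in\mathbb Z : x^{p-1}\equiv 1 \bmod p^3\},$$ and also $\mathscr S_1\big((\mathbb Z/p\mathbb Z)^3\big)=\mathscr T_3$, so that $\mathscr S_1(H_p)=\mathscr S_1\big((\mathbb Z/p\mathbb Z)^3\big)$. -/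

import Mathlib

/-- The Heisenberg group `H(R)`: the upper triangular `3 × 3` matrices with ones on the diagonal,
under matrix multiplication, as a subgroup of `GL₃(R)`. -/
def heisenberg (R : Type*) [CommRing R] : Subgroup (GL (Fin 3) R) where
  carrier := {M | ∃ a b c : R, (M : Matrix (Fin 3) (Fin 3) R) = !![1, a, c; 0, 1, b; 0, 0, 1]}
  one_mem' := ⟨0, 0, 0, by
    ext i j
    fin_cases i <;> fin_cases j <;> simp⟩
  mul_mem' := by
    rintro M N ⟨a, b, c, hM⟩ ⟨a', b', c', hN⟩
    refine ⟨a + a', b + b', c + a * b' + c', ?_⟩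
    rw [Units.val_mul, hM, hN]
    ext i j
    fin_cases i <;> fin_cases j <;>
      simp [Matrix.mul_apply, Fin.sum_univ_three] <;> ring
  inv_mem' := by
    rintro M ⟨a, b, c, hM⟩
    refine ⟨-a, -b, a * b - c, ?_⟩
    refine Units.inv_eq_of_mul_eq_one_right ?_
    rw [hM]
    ext i j
    fin_cases i <;> fin_cases j <;>
      simp [Matrix.mul_apply, Fin.sum_univ_three] <;> ring

noncomputable instance heisenbergFintype (R : Type*) [CommRing R] [Finite R] :
    Fintype (heisenberg R) :=
  Fintype.ofFinite _

/-- The integer group determinant `det (a_{g h⁻¹})`, rows indexed by `g` and columns by `h`. -/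
def groupDet (G : Type*) [Group G] [Fintype G] [DecidableEq G] (a : G → ℤ) : ℤ :=
  (Matrix.of fun g h : G => a (g * h⁻¹)).det

/-- `𝒮(G)`: the values taken by the group determinant of `G` at integer variables. -/
def groupDetValues (G : Type*) [Group G] [Fintype G] [DecidableEq G] : Set ℤ :=
  {d | ∃ a : G → ℤ, groupDet G a = d}

/-- `𝒮₁(G)`: the integer group determinants of `G` that are coprime to `p`. -/
def coprimeGroupDetValues (p : ℕ) (G : Type*) [Group G] [Fintype G] [DecidableEq G] : Set ℤ :=
  {d | d ∈ groupDetValues G ∧ IsCoprime d (p : ℤ)}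

/-- `𝒯ₙ = {m ∈ ℤ : m ≡ a ^ (p ^ (n - 1)) mod p ^ n for some 1 ≤ a < p}`, for `n ≥ 1`. -/
def teichmullerSet (p n : ℕ) : Set ℤ :=
  {m | ∃ a : ℕ, 1 ≤ a ∧ a < p ∧ m ≡ (a : ℤ) ^ p ^ (n - 1) [ZMOD (p : ℤ) ^ n]}

/-! The group determinant is the norm `N` of the group algebra: the determinant of left
multiplication. It is multiplicative; write `ε` for the augmentation. Only three properties of `G`
matter: order `p ^ 3`, exponent `p`, and a surjection onto `(ℤ/p)²`.

Every value is constrained by `N(x) ≡ ε(x) ^ p ^ 3` modulo `p ^ 3` (`nrm_modEq_augmentation_pow`).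
It holds for `1 - s g`, by reduction to the cyclic group `⟨g⟩`. Deforming `x` to `1 + X (x - 1)` and
working modulo powers of `X`, multiplication by such factors reduces the element to `1`; then `X =
1` gives the result. Fermat turns `ε(x) ^ p ^ 3` into `a ^ p ^ 2`, where `a` is the residue of
`ε(x)` modulo `p`.

Conversely, for a surjection `π : G → Q`, the identity `nrm_add_pullback_mul` tells how `N` changes
when a function on `Q` is pulled back and added. On a cyclic group of order `p`, a geometric sum has
norm and augmentation both `a`. Climbing through `(ℤ/p)²` to `G`, each step with kernel of order
`p`, raises this common value to the power `p`, giving `a ^ p ^ 2`. Adding multiples of the sum of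
all group elements then reaches its whole class modulo `p ^ 3`. -/

namespace GroupDeterminant

/-! ### The norm of the group algebra and its restriction to subgroups -/

variable {R S : Type*} [CommRing R] [CommRing S]
variable {G Q : Type*} [Group G] [Fintype G] [DecidableEq G] [Group Q] [Fintype Q] [DecidableEq Q]

/-- The matrix of left multiplication by `g`. -/
def leftMulMatrix (R : Type*) [CommRing R] (G : Type*) [Group G] [Fintype G] [DecidableEq G] :
    G →* Matrix G G R where
  toFun g := Matrix.of fun i j => if i * j⁻¹ = g then 1 else 0
  map_one' := by
    ext i j
    simp [Matrix.one_apply, mul_inv_eq_one]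
  map_mul' g h := by
    ext i j
    simp only [Matrix.mul_apply, Matrix.of_apply, ite_mul, one_mul, zero_mul]
    rw [Finset.sum_eq_single (h * j)]
    · have : i * (h * j)⁻¹ = g ↔ i * j⁻¹ = g * h := by
        rw [mul_inv_rev, ← mul_assoc, mul_inv_eq_iff_eq_mul]
      simp only [this, mul_inv_cancel_right, if_true]
    · intro k _ hk
      have : ¬ k * j⁻¹ = h := fun e => hk (by rw [← e]; group)
      simp [this]
    · simp

/-- The left regular representation of the group algebra by matrices. -/
noncomputable def groupMatrix : MonoidAlgebra R G →ₐ[R] Matrix G G R :=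
  MonoidAlgebra.lift R (Matrix G G R) G (leftMulMatrix R G)

theorem groupMatrix_single_apply (g : G) (r : R) (i j : G) :
    groupMatrix (MonoidAlgebra.single g r) i j = if i * j⁻¹ = g then r else 0 := by
  rw [groupMatrix, MonoidAlgebra.lift_single]
  simp [leftMulMatrix]

theorem groupMatrix_apply (x : MonoidAlgebra R G) (i j : G) :
    groupMatrix x i j = x.coeff (i * j⁻¹) := by
  induction x using MonoidAlgebra.induction_linear with
  | zero => simp
  | add x y hx hy => simp [hx, hy]
  | single g r => simp [groupMatrix_single_apply, Finsupp.single_apply, eq_comm]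

/-- The norm of a group algebra element: the determinant of left multiplication by it. -/
noncomputable def nrm : MonoidAlgebra R G →* R :=
  Matrix.detMonoidHom.comp (groupMatrix (R := R) (G := G) : MonoidAlgebra R G →* Matrix G G R)

theorem nrm_eq (x : MonoidAlgebra R G) : nrm x = (groupMatrix x).det := rfl

theorem nrm_map (f : R →+* S) (x : MonoidAlgebra R G) :
    nrm (MonoidAlgebra.mapRingHom G f x) = f (nrm x) := by
  rw [nrm_eq, nrm_eq, RingHom.map_det]
  congr 1
  ext i j
  simp [groupMatrix_apply]

theorem groupDet_eq_nrm (a : G → ℤ) :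
    groupDet G a = nrm (MonoidAlgebra.ofCoeff (Finsupp.equivFunOnFinite.symm a)) := by
  rw [nrm_eq, groupDet]
  congr 1
  ext i j
  simp [groupMatrix_apply]

theorem mem_groupDetValues_iff (d : ℤ) :
    d ∈ groupDetValues G ↔ ∃ x : MonoidAlgebra ℤ G, nrm x = d := by
  constructor
  · rintro ⟨a, rfl⟩
    exact ⟨_, (groupDet_eq_nrm a).symm⟩
  · rintro ⟨x, rfl⟩
    refine ⟨x.coeff, ?_⟩
    rw [groupDet_eq_nrm]
    congr 1
    ext g
    simp

theorem nrm_single_one (r : R) : nrm (MonoidAlgebra.single (1 : G) r) = r ^ Fintype.card G := by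
  have : groupMatrix (MonoidAlgebra.single (1 : G) r) = Matrix.diagonal fun _ => r := by
    ext i j
    simp [groupMatrix_single_apply, Matrix.diagonal_apply, mul_inv_eq_one]
  rw [nrm_eq, this, Matrix.det_diagonal]
  simp

theorem nrm_of_subsingleton [Subsingleton G] (x : MonoidAlgebra R G) : nrm x = x.coeff 1 := by
  let : Unique G := ⟨⟨1⟩, fun _ => Subsingleton.elim _ _⟩
  rw [nrm_eq, Matrix.det_unique, groupMatrix_apply, mul_inv_cancel]

/-- The norm of an element supported on a subgroup. -/
theorem nrm_mapDomain_subtype (H : Subgroup G) [Fintype H] (y : MonoidAlgebra R H) :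
    nrm (MonoidAlgebra.mapDomainRingHom R H.subtype y) = nrm y ^ H.index := by
  classical
  -- Left multiplication by `H` preserves right cosets; inverting the representatives of the left
  -- cosets `G ⧸ H` gives representatives of these.
  let f : H × (G ⧸ H) → G := fun a => a.1 * (Quotient.out a.2)⁻¹
  have hf : Function.Bijective f := by
    constructor
    · rintro ⟨h, q⟩ ⟨h', q'⟩ (e : (h : G) * (Quotient.out q)⁻¹ = h' * (Quotient.out q')⁻¹)
      have hq : q = q' := by
        rw [← Quotient.out_eq' q, ← Quotient.out_eq' q', QuotientGroup.eq]
        have : (Quotient.out q)⁻¹ * Quotient.out q' = (h : G)⁻¹ * h' := by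
          rw [eq_inv_mul_iff_mul_eq, ← mul_assoc, e, inv_mul_cancel_right]
        rw [this]
        exact H.mul_mem (H.inv_mem h.2) h'.2
      subst hq
      rw [mul_left_inj] at e
      rw [Subtype.ext e]
    · intro g
      refine ⟨(⟨g * Quotient.out ((g⁻¹ : G) : G ⧸ H), ?_⟩, (g⁻¹ : G)), ?_⟩
      · have : ((g⁻¹ : G) : G ⧸ H) = (Quotient.out ((g⁻¹ : G) : G ⧸ H) : G) := (Quotient.out_eq' _).symm
        rw [QuotientGroup.eq, inv_inv] at this
        exact this
      · simp [f]
  let e := Equiv.ofBijective f hf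
  have he : ∀ h q, e (h, q) = h * (Quotient.out q)⁻¹ := fun _ _ => rfl
  have key : (groupMatrix (MonoidAlgebra.mapDomainRingHom R H.subtype y)).submatrix e e
      = Matrix.blockDiagonal fun _ : G ⧸ H => groupMatrix y := by
    ext ⟨h, q⟩ ⟨h', q'⟩
    rw [Matrix.submatrix_apply, Matrix.blockDiagonal_apply, he, he]
    induction y using MonoidAlgebra.induction_linear with
    | zero => simp
    | add x y hx hy =>
      simp only [map_add, Matrix.add_apply, hx, hy]
      split_ifs <;> simp
    | single g r =>
      simp only [MonoidAlgebra.mapDomainRingHom_apply, MonoidAlgebra.mapDomain_single,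
        groupMatrix_single_apply]
      by_cases hq : q = q'
      · subst hq
        simp [← Subtype.coe_inj]
      · rw [if_neg hq, if_neg]
        intro h0
        apply hq
        rw [← Quotient.out_eq' q, ← Quotient.out_eq' q', QuotientGroup.eq]
        have : (Quotient.out q)⁻¹ * Quotient.out q' = (h : G)⁻¹ * g * h' := by
          rw [Subgroup.subtype_apply] at h0
          rw [← h0]; group
        rw [this]
        exact H.mul_mem (H.mul_mem (H.inv_mem h.2) g.2) h'.2
  rw [nrm_eq, nrm_eq, ← Matrix.det_submatrix_equiv_self e, key, Matrix.det_blockDiagonal]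
  simp [Subgroup.index, Nat.card_eq_fintype_card]

/-! ### Norms and quotients -/

/-- The incidence matrix of a map of groups. -/
def fiberMatrix (R : Type*) [CommRing R] (π : G →* Q) : Matrix G Q R :=
  Matrix.of fun g q => if π g = q then 1 else 0

/-- The pullback of a group algebra element along a homomorphism, as a function on the group. -/
noncomputable def pullback (π : G →* Q) (w : MonoidAlgebra R Q) : MonoidAlgebra R G :=
  MonoidAlgebra.ofCoeff (Finsupp.equivFunOnFinite.symm fun g => w.coeff (π g))

theorem groupMatrix_pullback (π : G →* Q) (w : MonoidAlgebra R Q) :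
    groupMatrix (pullback π w) = fiberMatrix R π * groupMatrix w * (fiberMatrix R π).transpose := by
  ext i j
  simp [groupMatrix_apply, pullback, Matrix.mul_apply, fiberMatrix]

/-- The incidence matrix sends a function on `Q` to its composite with `π`, and this intertwines the
two regular representations. -/
theorem groupMatrix_mul_fiberMatrix (π : G →* Q) (y : MonoidAlgebra R G) :
    groupMatrix y * fiberMatrix R π =
      fiberMatrix R π * groupMatrix (MonoidAlgebra.mapDomainRingHom R π y) := by
  induction y using MonoidAlgebra.induction_linear with
  | zero => simp
  | add x y hx hy => simp only [map_add, Matrix.add_mul, Matrix.mul_add, hx, hy]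
  | single g r =>
    ext i q
    simp only [Matrix.mul_apply, MonoidAlgebra.mapDomainRingHom_apply,
      MonoidAlgebra.mapDomain_single, groupMatrix_single_apply, fiberMatrix, Matrix.of_apply,
      ite_mul, one_mul, zero_mul, Finset.sum_ite_eq, Finset.mem_univ, if_true]
    rw [Finset.sum_eq_single (g⁻¹ * i)]
    · have : π (g⁻¹ * i) = q ↔ π i * q⁻¹ = π g := by
        rw [map_mul, map_inv, inv_mul_eq_iff_eq_mul, mul_inv_eq_iff_eq_mul]
      simp only [this, mul_inv_rev, mul_inv_cancel_left, inv_inv, if_true,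
        mul_one, mul_ite, mul_zero]
    · intro k _ hk
      have : ¬ i * k⁻¹ = g := fun e => hk (by rw [← e]; group)
      simp [this]
    · simp

omit [DecidableEq G] [Fintype Q] in
theorem card_fiber (π : G →* Q) (hπ : Function.Surjective π) (q : Q) :
    (Finset.univ.filter fun g => π g = q).card = Nat.card π.ker := by
  rw [Nat.card_eq_fintype_card, Fintype.card_subtype,
    MonoidHom.card_fiber_eq_of_mem_range π (hπ q) ⟨1, map_one π⟩]
  simp only [MonoidHom.mem_ker]

omit [DecidableEq G] [Fintype Q] in
theorem fiberMatrix_transpose_mul_self (π : G →* Q) (hπ : Function.Surjective π) :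
    (fiberMatrix R π).transpose * fiberMatrix R π = (Nat.card π.ker : R) • 1 := by
  ext q q'
  simp only [Matrix.mul_apply, Matrix.transpose_apply, fiberMatrix, Matrix.of_apply,
    Matrix.smul_apply, Matrix.one_apply, smul_eq_mul, mul_ite, mul_one, mul_zero]
  by_cases h : q = q'
  · subst h
    obtain ⟨g, rfl⟩ := hπ q
    simp [← Finset.sum_filter, Finset.filter_filter, card_fiber π hπ]
  · rw [if_neg h]
    refine Finset.sum_eq_zero fun g _ => ?_
    split_ifs with h1 h2 <;> first | rfl | exact absurd (h2.symm.trans h1) h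

/-- With `U P = P B`, the matrix `U + P W Pᵀ` factors as `U (1 + P B⁻¹ W Pᵀ)`. Sylvester's identity
`det (1 + A C) = det (1 + C A)` moves the second factor to `Q`, where `Pᵀ P` is the scalar `|ker
π|`. -/
theorem nrm_add_pullback_mul_of_field {K : Type*} [Field K] (π : G →* Q)
    (hπ : Function.Surjective π) (y : MonoidAlgebra K G) (w : MonoidAlgebra K Q)
    (hy : nrm (MonoidAlgebra.mapDomainRingHom K π y) ≠ 0) :
    nrm (y + pullback π w) * nrm (MonoidAlgebra.mapDomainRingHom K π y) =
      nrm y * nrm (MonoidAlgebra.mapDomainRingHom K π y + (Nat.card π.ker : K) • w) := by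
  simp only [nrm_eq, map_add, groupMatrix_pullback, map_smul] at hy ⊢
  have hUP := groupMatrix_mul_fiberMatrix π y
  have hPP := fiberMatrix_transpose_mul_self (R := K) π hπ
  set U := groupMatrix y
  set B := groupMatrix (MonoidAlgebra.mapDomainRingHom K π y)
  set W := groupMatrix w
  set P := fiberMatrix K π
  have hB : IsUnit B.det := isUnit_iff_ne_zero.2 hy
  have h1 : U + P * W * P.transpose = U * (1 + P * (B⁻¹ * W * P.transpose)) := by
    rw [Matrix.mul_add, mul_one, ← Matrix.mul_assoc U P, hUP, Matrix.mul_assoc P B,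
      ← Matrix.mul_assoc B, ← Matrix.mul_assoc B, Matrix.mul_nonsing_inv _ hB, Matrix.one_mul,
      Matrix.mul_assoc]
  have h2 : B + (Nat.card π.ker : K) • W = B * (1 + B⁻¹ * W * P.transpose * P) := by
    rw [Matrix.mul_assoc _ P.transpose, hPP, Matrix.mul_add, mul_one, ← Matrix.mul_assoc B,
      ← Matrix.mul_assoc B, Matrix.mul_nonsing_inv _ hB, Matrix.one_mul]
    simp
  rw [h1, h2, Matrix.det_mul, Matrix.det_mul, Matrix.det_one_add_mul_comm]
  ring

theorem nrm_add_pullback_mul (π : G →* Q)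
    (hπ : Function.Surjective π) (y : MonoidAlgebra ℤ G) (w : MonoidAlgebra ℤ Q)
    (hy : nrm (MonoidAlgebra.mapDomainRingHom ℤ π y) ≠ 0) :
    nrm (y + pullback π w) * nrm (MonoidAlgebra.mapDomainRingHom ℤ π y) =
      nrm y * nrm (MonoidAlgebra.mapDomainRingHom ℤ π y + (Nat.card π.ker : ℤ) • w) := by
  let f := Int.castRingHom ℚ
  have hf : Function.Injective f := Int.cast_injective
  have hmap : MonoidAlgebra.mapDomainRingHom ℚ π (MonoidAlgebra.mapRingHom G f y) =
      MonoidAlgebra.mapRingHom Q f (MonoidAlgebra.mapDomainRingHom ℤ π y) :=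
    DFunLike.congr_fun (MonoidAlgebra.mapRingHom_comp_mapDomainRingHom f π).symm y
  have hpull : pullback π (MonoidAlgebra.mapRingHom Q f w) =
      MonoidAlgebra.mapRingHom G f (pullback π w) := by
    ext g
    simp [pullback]
  have hsmul : (Nat.card π.ker : ℚ) • MonoidAlgebra.mapRingHom Q f w =
      MonoidAlgebra.mapRingHom Q f ((Nat.card π.ker : ℤ) • w) := by
    ext g
    rw [MonoidAlgebra.coeff_mapRingHom, MonoidAlgebra.coeff_smul_apply,
      MonoidAlgebra.coeff_smul_apply, MonoidAlgebra.coeff_mapRingHom, smul_eq_mul, smul_eq_mul,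
      map_mul, map_natCast]
  have := nrm_add_pullback_mul_of_field π hπ (MonoidAlgebra.mapRingHom G f y)
    (MonoidAlgebra.mapRingHom Q f w) (by
      rw [hmap, nrm_map]
      exact (map_ne_zero_iff f hf).2 hy)
  rw [hpull, hmap, hsmul, ← map_add, ← map_add] at this
  simp only [nrm_map, ← map_mul] at this
  exact hf this

/-! ### The congruence between norm and augmentation -/

/-- The augmentation of the group algebra. -/
noncomputable def augmentation : MonoidAlgebra R G →ₐ[R] R :=
  MonoidAlgebra.lift R R G 1

omit [Fintype G] [DecidableEq G] in
@[simp]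
theorem augmentation_single (g : G) (r : R) : augmentation (MonoidAlgebra.single g r) = r := by
  simp [augmentation]

omit [Fintype G] [DecidableEq G] in
theorem augmentation_mapRingHom (f : R →+* S) (x : MonoidAlgebra R G) :
    augmentation (MonoidAlgebra.mapRingHom G f x) = f (augmentation x) := by
  induction x using MonoidAlgebra.induction_linear with
  | zero => simp
  | add x y hx hy => simp only [map_add, hx, hy]
  | single g r => simp

omit [Fintype G] [DecidableEq G] in
theorem mapRingHom_smul (f : R →+* S) (r : R) (x : MonoidAlgebra R G) :
    MonoidAlgebra.mapRingHom G f (r • x) = f r • MonoidAlgebra.mapRingHom G f x := by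
  ext g
  rw [MonoidAlgebra.coeff_mapRingHom, MonoidAlgebra.coeff_smul_apply,
    MonoidAlgebra.coeff_smul_apply, MonoidAlgebra.coeff_mapRingHom, smul_eq_mul, smul_eq_mul,
    map_mul]

omit [Fintype G] [DecidableEq G] in
theorem one_sub_single_one (s : R) :
    (1 : MonoidAlgebra R G) - MonoidAlgebra.single 1 s = MonoidAlgebra.single 1 (1 - s) := by
  rw [MonoidAlgebra.single_sub, MonoidAlgebra.one_def]

/-- In characteristic `p`, `(1 - s g) ^ p` is the scalar `(1 - s) ^ p`. So the two sides have the
same `p`-th power, and Frobenius is injective on a domain. -/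
theorem nrm_one_sub_single_of_charP (p : ℕ) [Fact p.Prime] [IsDomain R] [CharP R p]
    (hG : Fintype.card G = p) {g : G} (hg : g ^ p = 1) (s : R) :
    nrm (1 - MonoidAlgebra.single g s) = (1 - s) ^ p := by
  apply frobenius_inj R p
  have h : (groupMatrix (1 - MonoidAlgebra.single g s)) ^ p =
      groupMatrix (MonoidAlgebra.single (1 : G) ((1 - s) ^ p)) := by
    rw [map_sub, map_one, sub_pow_char_of_commute p (Commute.one_left _), one_pow, ← map_pow,
      MonoidAlgebra.single_pow, hg, sub_pow_char, one_pow, ← one_sub_single_one, map_sub, map_one]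
  rw [frobenius_def, frobenius_def, nrm_eq, ← Matrix.det_pow, h, ← nrm_eq, nrm_single_one, hG]

/-- The generic case `s = X` over `ℤ[X]` reduces modulo `p` to the domain `𝔽_p[X]`; specialising `X`
to `s` then covers every ring. -/
theorem prime_dvd_nrm_one_sub_single (p : ℕ) [Fact p.Prime]
    (hG : Fintype.card G = p) {g : G} (hg : g ^ p = 1) (s : R) :
    (p : R) ∣ nrm (1 - MonoidAlgebra.single g s) - (1 - s) ^ p := by
  have h : (p : Polynomial ℤ) ∣
      nrm (1 - MonoidAlgebra.single g Polynomial.X) - (1 - Polynomial.X) ^ p := by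
    have h0 := nrm_one_sub_single_of_charP (R := Polynomial (ZMod p)) p hG hg Polynomial.X
    rw [← Polynomial.C_eq_natCast, Polynomial.C_dvd_iff_dvd_coeff]
    intro i
    rw [← ZMod.intCast_zmod_eq_zero_iff_dvd]
    have h1 : Polynomial.mapRingHom (Int.castRingHom (ZMod p))
        (nrm (1 - MonoidAlgebra.single g Polynomial.X) - (1 - Polynomial.X) ^ p) = 0 := by
      rw [map_sub, ← nrm_map]
      simpa [sub_eq_zero] using h0
    rw [Polynomial.coe_mapRingHom] at h1
    rw [← eq_intCast (Int.castRingHom (ZMod p)), ← Polynomial.coeff_map, h1, Polynomial.coeff_zero]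
  let φ : Polynomial ℤ →+* R := (Polynomial.aeval s).toRingHom
  have h1 := map_dvd φ h
  rw [map_sub, ← nrm_map] at h1
  simpa [φ] using h1

/-- The norm from `G` is the `p ^ n`-th power of the norm from `⟨g⟩`, and each `p`-th power improves
a congruence modulo `p` by one more factor `p`. -/
theorem card_dvd_nrm_one_sub_single (p n : ℕ) [Fact p.Prime]
    (hG : Fintype.card G = p ^ (n + 1)) {g : G} (hg : g ^ p = 1) (s : R) :
    (p : R) ^ (n + 1) ∣ nrm (1 - MonoidAlgebra.single g s) - (1 - s) ^ p ^ (n + 1) := by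
  classical
  by_cases h1 : g = 1
  · subst h1
    rw [one_sub_single_one, nrm_single_one, hG, sub_self]
    exact dvd_zero _
  · have hc : Fintype.card (Subgroup.zpowers g) = p := by
      rw [Fintype.card_zpowers]
      exact orderOf_eq_prime hg h1
    have hi : (Subgroup.zpowers g).index = p ^ n := by
      have := (Subgroup.zpowers g).card_mul_index
      rw [Nat.card_eq_fintype_card, Nat.card_eq_fintype_card, hc, hG, pow_succ'] at this
      exact Nat.eq_of_mul_eq_mul_left (Fact.out (p := p.Prime)).pos this
    let z : Subgroup.zpowers g := ⟨g, Subgroup.mem_zpowers g⟩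
    have hz : z ^ p = 1 := Subtype.ext hg
    have hm : MonoidAlgebra.mapDomainRingHom R (Subgroup.zpowers g).subtype
        (1 - MonoidAlgebra.single z s) = 1 - MonoidAlgebra.single g s := by
      rw [map_sub, map_one]
      simp [z]
    rw [← hm, nrm_mapDomain_subtype, hi, pow_succ' p n, pow_mul]
    exact dvd_sub_pow_of_dvd_sub (prime_dvd_nrm_one_sub_single p hc hz s) n

/-- Multiplying by `1 - t ^ d r g` removes the term `r g` at order `d` and disturbs only higher
orders. Both sides are multiplicative and agree on this factor, whose norm is a unit; `k` bounds the
orders left before `t` vanishes. -/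
theorem nrm_eq_augmentation_pow_of_nilpotent (p n : ℕ) [Fact p.Prime]
    (hG : Fintype.card G = p ^ (n + 1)) (hexp : ∀ g : G, g ^ p = 1)
    (hR : (p : R) ^ (n + 1) = 0) (t : R) (k d : ℕ) (ht : t ^ (d + k) = 0) (hd : 0 < d)
    (x : MonoidAlgebra R G) :
    nrm (1 + t ^ d • x) = augmentation (1 + t ^ d • x) ^ p ^ (n + 1) := by
  induction k generalizing d x with
  | zero =>
    rw [add_zero] at ht
    simp [ht]
  | succ k ih =>
    -- The tail `w` must be arbitrary, since removing one term of `x` changes it.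
    suffices h : ∀ w, nrm (1 + t ^ d • x + t ^ (d + 1) • w) =
        augmentation (1 + t ^ d • x + t ^ (d + 1) • w) ^ p ^ (n + 1) by simpa using h 0
    induction x using MonoidAlgebra.induction with
    | zero =>
      intro w
      simpa using ih (d + 1) (by rw [← ht]; ring) (by omega) w
    | single_add g r x _ _ hx =>
      intro w
      set y := 1 + t ^ d • (MonoidAlgebra.single g r + x) + t ^ (d + 1) • w with hy
      have hfac : nrm (1 - MonoidAlgebra.single g (t ^ d * r)) = (1 - t ^ d * r) ^ p ^ (n + 1) := by
        have := card_dvd_nrm_one_sub_single p n hG (hexp g) (t ^ d * r)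
        rw [hR, zero_dvd_iff, sub_eq_zero] at this
        exact this
      have hunit : IsUnit ((1 - t ^ d * r) ^ p ^ (n + 1)) := by
        refine IsUnit.pow _ (IsNilpotent.isUnit_one_sub ⟨d + (k + 1), ?_⟩)
        obtain ⟨e, rfl⟩ : ∃ e, d = e + 1 := ⟨d - 1, by omega⟩
        rw [mul_pow, ← pow_mul, mul_comm (e + 1), pow_mul, ht]
        simp
      obtain ⟨w', hw'⟩ : ∃ w', y * (1 - MonoidAlgebra.single g (t ^ d * r)) =
          1 + t ^ d • x + t ^ (d + 1) • w' := by
        obtain ⟨e, rfl⟩ : ∃ e, d = e + 1 := ⟨d - 1, by omega⟩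
        refine ⟨w - (t ^ e • (MonoidAlgebra.single g r + x) + t ^ (e + 1) • w) *
          MonoidAlgebra.single g r, ?_⟩
        have : MonoidAlgebra.single g (t ^ (e + 1) * r) =
          t ^ (e + 1) • MonoidAlgebra.single g r := by simp
        rw [this, hy]
        simp only [mul_sub, mul_one, add_mul, one_mul, smul_add, smul_sub, mul_smul_comm,
          smul_mul_assoc, smul_smul, ← pow_add]
        ring_nf
        abel
      have := hx w'
      rw [← hw', map_mul, map_mul, mul_pow, hfac, map_sub, map_one, augmentation_single] at this
      exact hunit.mul_right_cancel this

/-- For a `p`-group of exponent `p`, the group determinant is congruent modulo the order of the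
group to the corresponding power of the augmentation. -/
theorem nrm_modEq_augmentation_pow (p n : ℕ) [Fact p.Prime]
    (hG : Fintype.card G = p ^ (n + 1)) (hexp : ∀ g : G, g ^ p = 1) (x : MonoidAlgebra ℤ G) :
    nrm x ≡ augmentation x ^ p ^ (n + 1) [ZMOD (p : ℤ) ^ (n + 1)] := by
  let A := Polynomial (ZMod (p ^ (n + 1)))
  let f : ℤ →+* A := Int.castRingHom A
  have hA : (p : A) ^ (n + 1) = 0 := by
    have : ((p ^ (n + 1) : ℕ) : A) = 0 := CharP.cast_eq_zero A (p ^ (n + 1))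
    rwa [Nat.cast_pow] at this
  -- `Y` is `1` at `X = 0` and the reduction of `x` at `X = 1`; modulo each power of `X` the
  -- nilpotent case applies.
  let Y : MonoidAlgebra A G :=
    1 + (Polynomial.X : A) • (MonoidAlgebra.mapRingHom G f x - 1)
  have hY : nrm Y = augmentation Y ^ p ^ (n + 1) := by
    rw [← sub_eq_zero]
    have hdvd : ∀ M : ℕ, (Polynomial.X : A) ^ (M + 1) ∣
        nrm Y - augmentation Y ^ p ^ (n + 1) := by
      intro M
      rw [← Ideal.mem_span_singleton, ← Ideal.Quotient.eq_zero_iff_mem]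
      let I := Ideal.span {(Polynomial.X : A) ^ (M + 1)}
      let φ := Ideal.Quotient.mk I
      have h0 : (p : A ⧸ I) ^ (n + 1) = 0 := by
        have := congrArg φ hA
        simpa using this
      have h1 : φ Polynomial.X ^ (1 + M) = 0 := by
        rw [← map_pow, Ideal.Quotient.eq_zero_iff_mem, add_comm 1 M]
        exact Ideal.mem_span_singleton_self _
      have h2 := nrm_eq_augmentation_pow_of_nilpotent p n hG hexp h0 (φ Polynomial.X) M 1 h1
        one_pos (MonoidAlgebra.mapRingHom G φ (MonoidAlgebra.mapRingHom G f x - 1))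
      have h3 : MonoidAlgebra.mapRingHom G φ Y = 1 + φ Polynomial.X ^ 1 •
          MonoidAlgebra.mapRingHom G φ (MonoidAlgebra.mapRingHom G f x - 1) := by
        rw [map_add, map_one, pow_one, mapRingHom_smul]
      rw [← h3, nrm_map, augmentation_mapRingHom] at h2
      change φ _ = 0
      rw [map_sub, map_pow, h2, sub_self]
    ext i
    rw [Polynomial.coeff_zero]
    exact Polynomial.X_pow_dvd_iff.1 (hdvd i) i (Nat.lt_succ_self i)
  let ψ : A →+* ZMod (p ^ (n + 1)) := Polynomial.evalRingHom 1
  have hψ : MonoidAlgebra.mapRingHom G ψ Y =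
      MonoidAlgebra.mapRingHom G (Int.castRingHom (ZMod (p ^ (n + 1)))) x := by
    have hX : ψ Polynomial.X = 1 := Polynomial.eval_X
    rw [map_add, mapRingHom_smul, hX, one_smul, map_sub, map_one, add_sub_cancel]
    ext g
    simp [f]
  have h := congrArg ψ hY
  rw [map_pow, ← nrm_map, ← augmentation_mapRingHom, hψ, nrm_map, augmentation_mapRingHom,
    ← map_pow] at h
  have := (ZMod.intCast_eq_intCast_iff _ _ _).1 h
  exact_mod_cast this

/-! ### Elements whose norm equals their augmentation -/

omit [DecidableEq G] in
theorem augmentation_eq_sum (x : MonoidAlgebra R G) : augmentation x = ∑ g, x.coeff g := by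
  classical
  induction x using MonoidAlgebra.induction_linear with
  | zero => simp
  | add x y hx hy => simp [hx, hy, Finset.sum_add_distrib]
  | single g r => simp [Finsupp.single_apply]

omit [Fintype G] [DecidableEq G] [Fintype Q] [DecidableEq Q] in
theorem augmentation_mapDomainRingHom (π : G →* Q) (x : MonoidAlgebra R G) :
    augmentation (MonoidAlgebra.mapDomainRingHom R π x) = augmentation x := by
  induction x using MonoidAlgebra.induction_linear with
  | zero => simp
  | add x y hx hy => simp only [map_add, hx, hy]
  | single g r => simp

omit [DecidableEq G] in
theorem augmentation_pullback (π : G →* Q) (hπ : Function.Surjective π) (w : MonoidAlgebra R Q) :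
    augmentation (pullback π w) = Nat.card π.ker * augmentation w := by
  rw [augmentation_eq_sum, augmentation_eq_sum, Finset.mul_sum,
    ← Finset.sum_fiberwise Finset.univ π]
  refine Finset.sum_congr rfl fun q _ => ?_
  rw [Finset.sum_congr rfl (g := fun _ => w.coeff q), Finset.sum_const, card_fiber π hπ,
    nsmul_eq_mul]
  intro g hg
  simp [pullback, (Finset.mem_filter.1 hg).2]

theorem nrm_mapDomain_mulEquiv (e : G ≃* Q) (x : MonoidAlgebra R G) :
    nrm (MonoidAlgebra.mapDomainRingHom R (e : G →* Q) x) = nrm x := by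
  rw [nrm_eq, nrm_eq, ← Matrix.det_submatrix_equiv_self e.toEquiv]
  congr 1
  ext i j
  rw [Matrix.submatrix_apply]
  induction x using MonoidAlgebra.induction_linear with
  | zero => simp
  | add x y hx hy => simp only [map_add, Matrix.add_apply, hx, hy]
  | single g r =>
    simp [groupMatrix_single_apply, ← map_inv, ← map_mul]

/-- An integer that is both the norm and the augmentation of one group algebra element. -/
def IsNormAugmentation (G : Type*) [Group G] [Fintype G] [DecidableEq G] (m : ℤ) : Prop :=
  ∃ x : MonoidAlgebra ℤ G, nrm x = m ∧ augmentation x = m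

theorem nrm_add_pullback_one_mul (x : MonoidAlgebra ℤ G) (w : MonoidAlgebra ℤ Unit)
    (hx : augmentation x ≠ 0) :
    nrm (x + pullback (1 : G →* Unit) w) * augmentation x =
      nrm x * (augmentation x + Fintype.card G * augmentation w) := by
  have hN (z : MonoidAlgebra ℤ Unit) : nrm z = augmentation z := by
    rw [nrm_of_subsingleton, augmentation_eq_sum]
    simp
  have hk : Nat.card (1 : G →* Unit).ker = Fintype.card G := by
    rw [MonoidHom.ker_one, Nat.card_congr Subgroup.topEquiv.toEquiv, Nat.card_eq_fintype_card]
  have h := nrm_add_pullback_mul (1 : G →* Unit) (fun _ => ⟨1, rfl⟩) x w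
  rw [hN, hN, map_add augmentation, augmentation_mapDomainRingHom, map_smul, hk, smul_eq_mul] at h
  exact h hx

theorem IsNormAugmentation.of_modEq {e m : ℤ} (h : IsNormAugmentation G e) (he : e ≠ 0)
    (hm : m ≡ e [ZMOD Fintype.card G]) : IsNormAugmentation G m := by
  obtain ⟨x, hx, hx'⟩ := h
  obtain ⟨k, hk⟩ := hm.symm.dvd
  have hk' : m = e + Fintype.card G * k := by linarith
  let w : MonoidAlgebra ℤ Unit := MonoidAlgebra.single 1 k
  refine ⟨x + pullback (1 : G →* Unit) w, ?_, ?_⟩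
  · have := nrm_add_pullback_one_mul x w (by rwa [hx'])
    rw [hx', hx, augmentation_single, mul_comm] at this
    rw [hk']
    exact mul_left_cancel₀ he this
  · rw [map_add, hx', augmentation_pullback _ (fun _ => ⟨1, rfl⟩), augmentation_single,
      MonoidHom.ker_one, Nat.card_congr Subgroup.topEquiv.toEquiv, Nat.card_eq_fintype_card, hk']

/-- The sum of all group elements. -/
noncomputable def groupSum (R : Type*) [CommRing R] (G : Type*) [Group G] [Fintype G] :
    MonoidAlgebra R G :=
  pullback (1 : G →* Unit) 1

omit [DecidableEq G] in
theorem coeff_groupSum (g : G) : (groupSum R G).coeff g = 1 := by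
  simp [groupSum, pullback, MonoidAlgebra.one_def]

omit [DecidableEq G] in
theorem groupSum_mul (x : MonoidAlgebra R G) : groupSum R G * x = augmentation x • groupSum R G := by
  induction x using MonoidAlgebra.induction_linear with
  | zero => simp
  | add x y hx hy => simp only [map_add, mul_add, hx, hy, add_smul]
  | single g r =>
    ext h
    simp [coeff_groupSum, MonoidAlgebra.coeff_mul_single_apply]

/-- `z - 1` alone kills the constants. A kernel vector of the corrected element has sum zero, hence
is constant along the powers of `z`, hence vanishes. -/
theorem nrm_generator_sub_one_add_groupSum_ne_zero {z : G}
    (hz : ∀ g, g ∈ Submonoid.powers z) :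
    nrm (MonoidAlgebra.single z 1 - 1 + groupSum ℤ G) ≠ 0 := by
  intro h0
  rw [nrm_eq] at h0
  obtain ⟨v, hv, hv0⟩ := Matrix.exists_mulVec_eq_zero_iff.2 h0
  apply hv
  have h1 (i : G) : v (z⁻¹ * i) - v i + ∑ j, v j = 0 := by
    have := congrFun hv0 i
    rw [map_add, map_sub, map_one, Matrix.add_mulVec, Matrix.sub_mulVec, Matrix.one_mulVec] at this
    rw [← Pi.zero_apply (M := fun _ : G => ℤ) i, ← this, Pi.add_apply, Pi.sub_apply]
    congr 2
    · rw [Matrix.mulVec, dotProduct, Finset.sum_eq_single (z⁻¹ * i)]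
      · simp [groupMatrix_single_apply]
      · intro k _ hk
        have : ¬ i * k⁻¹ = z := fun e => hk (by rw [← e]; group)
        simp [groupMatrix_single_apply, this]
      · simp
    · simp [Matrix.mulVec, dotProduct, groupMatrix_apply, coeff_groupSum]
  have hc : (Fintype.card G : ℤ) ≠ 0 := by exact_mod_cast Fintype.card_ne_zero
  have h2 : ∑ j, v j = 0 := by
    have := Finset.sum_congr (rfl : (Finset.univ : Finset G) = _) fun i _ => h1 i
    rw [Finset.sum_add_distrib, Finset.sum_sub_distrib,
      show ∑ i, v (z⁻¹ * i) = ∑ i, v i from Equiv.sum_comp (Equiv.mulLeft z⁻¹) v, sub_self, zero_add] at this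
    simpa [hc] using this
  have h3 (k : ℕ) : v (z ^ k) = v 1 := by
    induction k with
    | zero => simp
    | succ k ih =>
      have := h1 (z ^ (k + 1))
      rw [h2, pow_succ', inv_mul_cancel_left, ih] at this
      rw [pow_succ']
      linarith
  have h4 (g : G) : v g = v 1 := by
    obtain ⟨k, rfl⟩ := hz g
    exact h3 k
  have h5 : v 1 = 0 := by
    simpa [h4, hc] using h2
  ext g
  rw [h4 g, h5]
  rfl

/-- Multiplying `u` by `z - 1` gives `z ^ a - 1`, the image of `z - 1` under the automorphism `g ↦ g
^ a`. Adding the group sum makes the norm nonzero, so that it can be cancelled; its contribution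
produces the factor `a`. -/
theorem nrm_geom_sum_generator {z : G} (hz : ∀ g, g ∈ Submonoid.powers z) {a : ℕ}
    (ha : (Fintype.card G).Coprime a) :
    nrm (∑ i ∈ Finset.range a, MonoidAlgebra.single z (1 : ℤ) ^ i) = a := by
  set u : MonoidAlgebra ℤ G := ∑ i ∈ Finset.range a, MonoidAlgebra.single z (1 : ℤ) ^ i with hu
  have hcomm (g h : G) : Commute g h := by
    obtain ⟨k, rfl⟩ := hz g
    obtain ⟨l, rfl⟩ := hz h
    exact (Commute.refl z).pow_pow k l
  let e : G ≃* G :=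
    { powCoprime (by rwa [Nat.card_eq_fintype_card]) with
      map_mul' := fun g h => (hcomm g h).mul_pow a }
  have he (g : G) : e g = g ^ a := rfl
  set y := MonoidAlgebra.single z 1 - 1 + groupSum ℤ G with hy
  have hy0 : nrm y ≠ 0 := nrm_generator_sub_one_add_groupSum_ne_zero hz
  set y' := MonoidAlgebra.single (z ^ a) 1 - 1 + groupSum ℤ G with hy'
  have hsum : MonoidAlgebra.mapDomainRingHom ℤ (e : G →* G) (groupSum ℤ G) = groupSum ℤ G := by
    ext g
    obtain ⟨h, rfl⟩ := e.surjective g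
    rw [coeff_groupSum, MonoidAlgebra.mapDomainRingHom_apply]
    exact (Finsupp.mapDomain_apply e.injective _ _).trans (coeff_groupSum h)
  have hyy' : nrm y' = nrm y := by
    rw [← nrm_mapDomain_mulEquiv e y]
    congr 1
    rw [hy, map_add, map_sub, map_one, hsum]
    simp [hy', he]
  have haug : augmentation u = a := by
    simp [hu, map_sum]
  have hmul : y * u = y' + pullback (1 : G →* Unit) (MonoidAlgebra.single 1 (a - 1 : ℤ)) := by
    rw [hy, add_mul, groupSum_mul, hu, mul_geom_sum, ← hu, haug, hy', MonoidAlgebra.single_pow,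
      one_pow, add_assoc]
    congr 1
    ext g
    rw [MonoidAlgebra.coeff_smul_apply, MonoidAlgebra.coeff_add, Finsupp.add_apply, coeff_groupSum]
    simp [pullback]
  have hy1 : augmentation y' = Fintype.card G := by
    rw [hy', map_add, map_sub, map_one, augmentation_single, augmentation_eq_sum]
    simp [coeff_groupSum]
  have hc : (Fintype.card G : ℤ) ≠ 0 := by exact_mod_cast Fintype.card_ne_zero
  have h := nrm_add_pullback_one_mul y' (MonoidAlgebra.single 1 (a - 1 : ℤ)) (by rwa [hy1])
  rw [← hmul, hy1, augmentation_single, map_mul, hyy'] at h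
  have : nrm y * Fintype.card G * (nrm u - a) = 0 := by linear_combination h
  have := (mul_eq_zero.1 this).resolve_left (mul_ne_zero hy0 hc)
  linarith

theorem isNormAugmentation_of_generator {z : G} (hz : ∀ g, g ∈ Submonoid.powers z) {a : ℕ}
    (ha : (Fintype.card G).Coprime a) : IsNormAugmentation G a :=
  ⟨_, nrm_geom_sum_generator hz ha, by simp [map_sum]⟩

/-! ### Lifting along a kernel of order `p` -/

omit [Fintype G] [DecidableEq G] in
theorem pow_eq_single_augmentation {C : Type*} [CommGroup C] (p : ℕ) [Fact p.Prime]
    (hexp : ∀ g : C, g ^ p = 1) (x : MonoidAlgebra (ZMod p) C) :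
    x ^ p = MonoidAlgebra.single 1 (augmentation x) := by
  have : CharP (MonoidAlgebra (ZMod p) C) p :=
    charP_of_injective_ringHom (f := MonoidAlgebra.singleOneRingHom)
      (MonoidAlgebra.single_right_injective (m := (1 : C))) p
  induction x using MonoidAlgebra.induction_linear with
  | zero => simp [(Fact.out (p := p.Prime)).ne_zero]
  | add x y hx hy => rw [add_pow_char, hx, hy, map_add, MonoidAlgebra.single_add]
  | single g r => rw [MonoidAlgebra.single_pow, hexp, ZMod.pow_card, augmentation_single]

/-- Modulo `p`, Frobenius sends `x` to its augmentation. The error is a multiple of `p`, which is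
the form needed when pulling back along a kernel of order `p`. -/
theorem exists_pow_eq_single_add_smul {C : Type*} [CommGroup C] (p : ℕ) [Fact p.Prime]
    (hexp : ∀ g : C, g ^ p = 1) (x : MonoidAlgebra ℤ C) {a : ℤ}
    (ha : a ≡ augmentation x [ZMOD p]) :
    ∃ w, x ^ p = MonoidAlgebra.single 1 a + (p : ℤ) • w := by
  have hp0 : (p : ℤ) ≠ 0 := by exact_mod_cast (Fact.out (p := p.Prime)).ne_zero
  let f := Int.castRingHom (ZMod p)
  have h : MonoidAlgebra.mapRingHom C f (x ^ p - MonoidAlgebra.single 1 a) = 0 := by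
    rw [map_sub, map_pow, pow_eq_single_augmentation p hexp, augmentation_mapRingHom,
      MonoidAlgebra.mapRingHom_single, sub_eq_zero]
    congr 1
    exact ((ZMod.intCast_eq_intCast_iff _ _ _).2 ha).symm
  refine ⟨MonoidAlgebra.ofCoeff ((x ^ p - MonoidAlgebra.single 1 a).coeff.mapRange (· / (p : ℤ))
    (Int.zero_ediv _)), ?_⟩
  rw [← sub_eq_iff_eq_add']
  ext g
  have h1 : (p : ℤ) ∣ (x ^ p - MonoidAlgebra.single 1 a).coeff g := by
    rw [← ZMod.intCast_zmod_eq_zero_iff_dvd]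
    have := congrArg (fun y => MonoidAlgebra.coeff y g) h
    rwa [MonoidAlgebra.coeff_mapRingHom] at this
  rw [MonoidAlgebra.coeff_smul_apply, MonoidAlgebra.coeff_ofCoeff, Finsupp.mapRange_apply,
    smul_eq_mul, Int.mul_ediv_cancel' h1]

omit [DecidableEq G] in
theorem mem_powers_zpowers_generator (z : G) (g : Subgroup.zpowers z) :
    g ∈ Submonoid.powers (⟨z, Subgroup.mem_zpowers z⟩ : Subgroup.zpowers z) := by
  obtain ⟨k, hk⟩ := (mem_powers_iff_mem_zpowers.2 g.2 : (g : G) ∈ Submonoid.powers z)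
  exact ⟨k, Subtype.ext hk⟩

/-- Lifting along a quotient by a subgroup of order `p`. -/
theorem IsNormAugmentation.pow_prime {C : Type*} [CommGroup C] [Fintype C] [DecidableEq C]
    (p : ℕ) [Fact p.Prime] (hexp : ∀ g : C, g ^ p = 1) (π : G →* C) (hπ : Function.Surjective π)
    (hcard : Fintype.card G = p * Fintype.card C) {e : ℤ} (he : IsCoprime e p)
    (h : IsNormAugmentation C e) : IsNormAugmentation G (e ^ p) := by
  obtain ⟨x, hx, hx'⟩ := h
  have hp : p.Prime := Fact.out
  have hker : Nat.card π.ker = p := by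
    have := π.ker.card_mul_index
    rw [Subgroup.index_ker, MonoidHom.range_eq_top.2 hπ, Subgroup.card_top,
      Nat.card_eq_fintype_card (α := G), hcard, Nat.card_eq_fintype_card (α := C)] at this
    exact Nat.eq_of_mul_eq_mul_right Fintype.card_pos this
  obtain ⟨z, hz1⟩ : ∃ z : π.ker, z ≠ 1 := by
    have : Nontrivial π.ker := Finite.one_lt_card_iff_nontrivial.1 (hker ▸ hp.one_lt)
    exact exists_ne 1
  have hzo : orderOf (z : G) = p := by
    rw [Subgroup.orderOf_coe]
    exact orderOf_eq_prime (by rw [← hker]; exact pow_card_eq_one') hz1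
  have hzc : Fintype.card (Subgroup.zpowers (z : G)) = p := by
    rw [Fintype.card_zpowers, hzo]
  have hzi : (Subgroup.zpowers (z : G)).index = Fintype.card C := by
    have := (Subgroup.zpowers (z : G)).card_mul_index
    rw [Nat.card_eq_fintype_card, Nat.card_eq_fintype_card, hzc, hcard] at this
    exact Nat.eq_of_mul_eq_mul_left hp.pos this
  -- A nonnegative representative of `e` modulo `p`, to serve as the length of a geometric sum in
  -- `z`. That sum maps to the scalar `a` in the quotient, so adding the pullback of `w` makes the
  -- quotient factor `N(a + p w) = N(x ^ p)`.
  let a := (e : ZMod p).val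
  have hae : (a : ℤ) ≡ e [ZMOD p] := by
    rw [← ZMod.intCast_eq_intCast_iff]
    simp [a]
  have hap : p.Coprime a := by
    rw [Nat.coprime_comm, ← Nat.isCoprime_iff_coprime]
    obtain ⟨k, hk⟩ := hae.dvd
    rw [show (a : ℤ) = e + p * (-k) by linarith]
    exact (IsCoprime.add_mul_left_left_iff).2 he
  have ha0 : (a : ℤ) ≠ 0 := by
    rintro h0
    rw [Nat.cast_eq_zero.1 h0, Nat.coprime_zero_right] at hap
    exact hp.one_lt.ne' hap
  obtain ⟨w, hw⟩ := exists_pow_eq_single_add_smul p hexp x (hx' ▸ hae)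
  let u : MonoidAlgebra ℤ G := ∑ i ∈ Finset.range a, MonoidAlgebra.single (z : G) (1 : ℤ) ^ i
  have hu : nrm u = (a : ℤ) ^ Fintype.card C := by
    rw [← hzi, ← nrm_geom_sum_generator (mem_powers_zpowers_generator (z : G)) (hzc ▸ hap),
      ← nrm_mapDomain_subtype]
    congr 1
    simp [u, map_sum]
  have hπu : MonoidAlgebra.mapDomainRingHom ℤ π u = MonoidAlgebra.single 1 (a : ℤ) := by
    have : π z = 1 := z.2
    simp [u, map_sum, this, ← MonoidAlgebra.one_def, MonoidAlgebra.natCast_def]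
  refine ⟨u + pullback π w, ?_, ?_⟩
  · have := nrm_add_pullback_mul π hπ u w (by
      rw [hπu, nrm_single_one]
      exact pow_ne_zero _ ha0)
    rw [hπu, nrm_single_one, hu, hker, ← hw, map_pow, hx, mul_comm] at this
    exact mul_left_cancel₀ (pow_ne_zero _ ha0) this
  · have := congrArg augmentation hw
    rw [map_pow, hx', map_add, augmentation_single, map_smul, smul_eq_mul] at this
    rw [map_add, augmentation_pullback π hπ, hker, this, ← augmentation_mapDomainRingHom π u, hπu,
      augmentation_single]

/-! ### Teichmüller residues and the general theorem -/

theorem pow_sq_modEq (p : ℕ) {x y : ℤ} (h : x ≡ y [ZMOD p]) :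
    x ^ p ^ 2 ≡ y ^ p ^ 2 [ZMOD (p : ℤ) ^ 3] := by
  have := dvd_sub_pow_of_dvd_sub (R := ℤ) h.symm.dvd 2
  exact (Int.modEq_iff_dvd.2 this).symm

theorem exists_nat_modEq_of_isCoprime (p : ℕ) [Fact p.Prime] {x : ℤ} (hx : IsCoprime x p) :
    ∃ a : ℕ, 1 ≤ a ∧ a < p ∧ (a : ℤ) ≡ x [ZMOD p] := by
  refine ⟨(x : ZMod p).val, ?_, ZMod.val_lt _, ?_⟩
  · rw [Nat.one_le_iff_ne_zero, Ne, ZMod.val_eq_zero, ZMod.intCast_zmod_eq_zero_iff_dvd]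
    intro h
    exact (Nat.prime_iff_prime_int.1 (Fact.out (p := p.Prime))).not_isUnit
      (hx.isUnit_of_dvd' h dvd_rfl)
  · rw [← ZMod.intCast_eq_intCast_iff]
    simp

theorem isCoprime_natCast_of_lt (p : ℕ) [Fact p.Prime] {a : ℕ} (ha : 1 ≤ a) (hap : a < p) :
    IsCoprime (a : ℤ) p :=
  Nat.isCoprime_iff_coprime.2
    (Nat.coprime_of_lt_prime (Nat.one_le_iff_ne_zero.1 ha) hap (Fact.out (p := p.Prime))).symm

theorem teichmullerSet_three (p : ℕ) [Fact p.Prime] :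
    teichmullerSet p 3 = {x : ℤ | x ^ (p - 1) ≡ 1 [ZMOD (p : ℤ) ^ 3]} := by
  have hp : p.Prime := Fact.out
  ext x
  constructor
  · rintro ⟨a, ha, hap, h⟩
    have h1 := pow_sq_modEq p (Int.ModEq.pow_card_sub_one_eq_one hp
      (isCoprime_natCast_of_lt p ha hap))
    rw [one_pow, ← pow_mul, mul_comm, pow_mul] at h1
    exact (h.pow (p - 1)).trans h1
  · intro (h : x ^ (p - 1) ≡ 1 [ZMOD (p : ℤ) ^ 3])
    have hx : IsCoprime x p := by
      have h1 : x ^ (p - 1) ≡ 1 [ZMOD p] := h.of_dvd (dvd_pow_self _ (by norm_num))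
      obtain ⟨k, hk⟩ := h1.dvd
      have : IsCoprime (x ^ (p - 1)) p := ⟨1, k, by linarith⟩
      exact (IsCoprime.pow_left_iff (Nat.sub_pos_of_lt hp.one_lt)).1 this
    obtain ⟨a, ha, hap, hax⟩ := exists_nat_modEq_of_isCoprime p hx
    refine ⟨a, ha, hap, ?_⟩
    have h1 := h.pow (p + 1)
    -- Hence `x ^ p ^ 2 ≡ x` modulo `p ^ 3`, while `x ^ p ^ 2` depends only on `x` modulo `p`.
    have h2 : (p - 1) * (p + 1) + 1 = p ^ 2 := by
      obtain ⟨q, rfl⟩ : ∃ q, p = q + 1 := ⟨p - 1, (Nat.succ_pred_prime hp).symm⟩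
      rw [Nat.add_sub_cancel]
      ring
    rw [one_pow, ← pow_mul] at h1
    have h3 := h1.mul_right x
    rw [one_mul, ← pow_succ, h2] at h3
    exact h3.symm.trans (pow_sq_modEq p hax).symm

/-- The group determinants coprime to `p` of a group of order `p ^ 3` and exponent `p` that has
an elementary abelian quotient of order `p ^ 2`. -/
theorem coprimeGroupDetValues_eq_teichmullerSet (p : ℕ) [Fact p.Prime] {G : Type*} [Group G]
    [Fintype G] [DecidableEq G] (hcard : Fintype.card G = p ^ 3) (hexp : ∀ g : G, g ^ p = 1)
    (π : G →* Multiplicative (ZMod p × ZMod p)) (hπ : Function.Surjective π) :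
    coprimeGroupDetValues p G = teichmullerSet p 3 := by
  have hp : p.Prime := Fact.out
  ext d
  constructor
  · rintro ⟨hd, hdp⟩
    obtain ⟨x, rfl⟩ := (mem_groupDetValues_iff d).1 hd
    have h := nrm_modEq_augmentation_pow p 2 hcard hexp x
    have hx : IsCoprime (augmentation x) (p : ℤ) := by
      obtain ⟨k, hk⟩ := (h.of_dvd (dvd_pow_self (p : ℤ) (by norm_num : 2 + 1 ≠ 0))).dvd
      refine (IsCoprime.pow_left_iff (pow_pos hp.pos (2 + 1))).1 ?_
      rw [show augmentation x ^ p ^ (2 + 1) = nrm x + p * k by linarith]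
      exact IsCoprime.add_mul_left_left_iff.2 hdp
    obtain ⟨a, ha, hap, hax⟩ := exists_nat_modEq_of_isCoprime p hx
    refine ⟨a, ha, hap, h.trans ?_⟩
    -- Write the power as `(ε(x) ^ p) ^ p ^ 2` and apply Fermat to the inner one.
    rw [pow_succ' p 2, pow_mul]
    refine pow_sq_modEq p (Int.ModEq.trans ?_ hax.symm)
    rw [← ZMod.intCast_eq_intCast_iff]
    simp
  · rintro ⟨a, ha, hap, hd⟩
    change d ≡ _ [ZMOD (p : ℤ) ^ 3] at hd
    have hac := isCoprime_natCast_of_lt p ha hap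
    have hd' : IsCoprime d (p : ℤ) := by
      obtain ⟨k, hk⟩ := (hd.of_dvd (dvd_pow_self (p : ℤ) (by norm_num))).symm.dvd
      rw [show d = (a : ℤ) ^ p ^ (3 - 1) + p * k by linarith]
      exact IsCoprime.add_mul_left_left_iff.2 hac.pow_left
    refine ⟨?_, hd'⟩
    have hC : IsNormAugmentation (Multiplicative (ZMod p)) a := by
      refine isNormAugmentation_of_generator (z := Multiplicative.ofAdd 1) (fun g => ?_) ?_
      · refine ⟨(Multiplicative.toAdd g).val, ?_⟩
        change Multiplicative.ofAdd 1 ^ _ = g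
        rw [← ofAdd_nsmul]
        simp
      · rw [Fintype.card_multiplicative, ZMod.card]
        exact (Nat.isCoprime_iff_coprime.1 hac).symm
    have hC2 : IsNormAugmentation (Multiplicative (ZMod p × ZMod p)) ((a : ℤ) ^ p) := by
      refine hC.pow_prime p (fun g => ?_) (AddMonoidHom.toMultiplicative (AddMonoidHom.fst _ _))
        (fun g => ⟨Multiplicative.ofAdd (g.toAdd, 0), rfl⟩) ?_ hac
      · rw [← ofAdd_toAdd g, ← ofAdd_nsmul]
        simp
      · simp [ZMod.card]
    have hG : IsNormAugmentation G (((a : ℤ) ^ p) ^ p) := by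
      refine hC2.pow_prime p (fun g => ?_) π hπ ?_ hac.pow_left
      · rw [← ofAdd_toAdd g, ← ofAdd_nsmul]
        ext <;> simp
      · rw [hcard, Fintype.card_multiplicative, Fintype.card_prod, ZMod.card]
        ring
    rw [← pow_mul, ← pow_two] at hG
    have ha0 : (a : ℤ) ^ p ^ 2 ≠ 0 := pow_ne_zero _ (by exact_mod_cast (by omega : a ≠ 0))
    obtain ⟨x, hx, -⟩ := hG.of_modEq ha0 (m := d) (by rw [hcard]; exact_mod_cast hd)
    exact (mem_groupDetValues_iff d).2 ⟨x, hx⟩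

/-! ### The Heisenberg group -/

/-- The unipotent matrix with given entries, as an element of the Heisenberg group. -/
def heisenbergMk {R : Type*} [CommRing R] (a b c : R) : heisenberg R :=
  ⟨⟨!![1, a, c; 0, 1, b; 0, 0, 1], !![1, -a, a * b - c; 0, 1, -b; 0, 0, 1], by
      ext i j
      fin_cases i <;> fin_cases j <;> simp [Matrix.mul_apply, Fin.sum_univ_three] <;> ring, by
      ext i j
      fin_cases i <;> fin_cases j <;> simp [Matrix.mul_apply, Fin.sum_univ_three] <;> ring⟩,
    a, b, c, rfl⟩

theorem exists_eq_heisenbergMk {R : Type*} [CommRing R] (g : heisenberg R) :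
    ∃ a b c, g = heisenbergMk a b c := by
  obtain ⟨g, a, b, c, h⟩ := g
  exact ⟨a, b, c, Subtype.ext (Units.ext h)⟩

/-- The coordinates of an element of the Heisenberg group. -/
def heisenbergEquiv (R : Type*) [CommRing R] : heisenberg R ≃ R × R × R where
  toFun g := (g.1 0 1, g.1 1 2, g.1 0 2)
  invFun t := heisenbergMk t.1 t.2.1 t.2.2
  left_inv g := by
    obtain ⟨a, b, c, rfl⟩ := exists_eq_heisenbergMk g
    simp [heisenbergMk]
  right_inv t := by simp [heisenbergMk]

/-- In characteristic `p`, `M ^ p - 1 = (M - 1) ^ p`, and `M - 1` is strictly upper triangular, so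
its cube is zero; this is where `3 ≤ p` enters. -/
theorem heisenberg_pow_prime (p : ℕ) [Fact p.Prime] (hp : 3 ≤ p) (g : heisenberg (ZMod p)) :
    g ^ p = 1 := by
  obtain ⟨a, b, c, rfl⟩ := exists_eq_heisenbergMk g
  apply Subtype.ext
  apply Units.ext
  rw [SubgroupClass.coe_pow, Units.val_pow_eq_pow_val, OneMemClass.coe_one, Units.val_one,
    ← sub_eq_zero]
  set M : Matrix (Fin 3) (Fin 3) (ZMod p) := (heisenbergMk a b c).1.1 with hM
  have h1 : M ^ p - 1 = (M - 1) ^ p := by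
    rw [sub_pow_char_of_commute p (Commute.one_right M), one_pow]
  have h2 : M - 1 = !![0, a, c; 0, 0, b; 0, 0, 0] := by
    rw [hM]
    ext i j
    fin_cases i <;> fin_cases j <;> simp [heisenbergMk]
  have h3 : (M - 1) ^ 3 = 0 := by
    rw [h2]
    ext i j
    fin_cases i <;> fin_cases j <;> simp [pow_succ, Matrix.mul_apply, Fin.sum_univ_three]
  rw [h1]
  exact pow_eq_zero_of_le hp h3

/-- The abelianization map of the Heisenberg group. -/
def heisenbergProj (R : Type*) [CommRing R] : heisenberg R →* Multiplicative (R × R) where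
  toFun g := Multiplicative.ofAdd (g.1 0 1, g.1 1 2)
  map_one' := by simp
  map_mul' g h := by
    obtain ⟨a, b, c, rfl⟩ := exists_eq_heisenbergMk g
    obtain ⟨a', b', c', rfl⟩ := exists_eq_heisenbergMk h
    rw [← ofAdd_add]
    simp [heisenbergMk, Matrix.mul_apply, Fin.sum_univ_three, add_comm]

theorem heisenbergProj_surjective (R : Type*) [CommRing R] :
    Function.Surjective (heisenbergProj R) := fun t =>
  ⟨heisenbergMk t.toAdd.1 t.toAdd.2 0, by simp [heisenbergProj, heisenbergMk]⟩

end GroupDeterminant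

open GroupDeterminant in
theorem corollary3p2 (p : ℕ) [Fact p.Prime] (hp : 3 ≤ p) :
    coprimeGroupDetValues p (heisenberg (ZMod p)) = teichmullerSet p 3 ∧
    teichmullerSet p 3 = {x : ℤ | x ^ (p - 1) ≡ 1 [ZMOD (p : ℤ) ^ 3]} ∧
    coprimeGroupDetValues p (Multiplicative (Fin 3 → ZMod p)) = teichmullerSet p 3 := by
  refine ⟨?_, teichmullerSet_three p, ?_⟩
  · refine coprimeGroupDetValues_eq_teichmullerSet p ?_ (heisenberg_pow_prime p hp)
      (heisenbergProj _) (heisenbergProj_surjective _)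
    rw [Fintype.card_congr (heisenbergEquiv (ZMod p)), Fintype.card_prod, Fintype.card_prod,
      ZMod.card]
    ring
  · refine coprimeGroupDetValues_eq_teichmullerSet p ?_ (fun g => ?_)
      (AddMonoidHom.toMultiplicative
        ((Pi.evalAddMonoidHom (fun _ : Fin 3 => ZMod p) 0).prod (Pi.evalAddMonoidHom _ 1)))
      (fun t => ⟨Multiplicative.ofAdd ![t.toAdd.1, t.toAdd.2, 0], rfl⟩)
    · simp [ZMod.card]
    · rw [← ofAdd_toAdd g, ← ofAdd_nsmul]
      simp
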